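/- All graphs are finite and simple. An $r$-partite graph is a graph together with a partition $V_1,\dots,V_r$ of its vertex set into (possibly empty) independent sets, called parts. For $0\le t\le r$, a $t$-IT of such a graph is an independent set of $t$ vertices that meets each part in at most one vertex. For $r, D,\Delta\in\mathbb{N}$ with $1\le D\le r$, let $n(r,D,\Delta)$ be the largest integer $n\ge 0$ for which there is an $r$-partite graph with at least $n$ vertices in each part, maximum degree $\Delta$, and no $(r-D+1)$-IT. For integers $n\ge 1$ and $2\le t\le r$, let $f(n,r,t)$ be the largest minimum degree $\delta(G)$ among all $r$-partite graphs $G$ with all parts of size exactly $n$ and without a copy of the complete graph $K_t$. **Corollary.** For every integer $\Delta\ge 0$, the maximum defining $n(6,2,\Delta)$ exists and $$n(6,2,\Delta)=\left\lfloor \tfrac54\Delta\right\rfloor .$$ For every integer $n\ge 1$, $$f(n,6,5)=\left\lfloor \tfrac{21}{5}n\right\rfloor .$$ -/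

import Mathlib

/-- `S` is an independent `t`-transversal (a `t`-IT) of the `r`-partite graph `G` whose parts are the
colour classes of `c`: an independent set with exactly one vertex in each of `t` of the parts
and no other vertices. -/
def IsPartialIT {V : Type} {r : ℕ} (G : SimpleGraph V) (c : G.Coloring (Fin r)) (t : ℕ)
    (S : Finset V) : Prop :=
  G.IsIndepSet (S : Set V) ∧ Set.InjOn c (S : Set V) ∧ S.card = t

open Classical in
/-- The set of those `n` for which there is a finite `r`-partite graph with at least `n` vertices in
each part, maximum degree `Δ`, and without an `(r - D + 1)`-IT. Its greatest element is the
extremal function `n(r, D, Δ)` (for `D ≤ r`). -/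
def transversalFreeSizes (r D Δ : ℕ) : Set ℕ :=
  {n | ∃ (V : Type) (_ : Fintype V) (G : SimpleGraph V) (c : G.Coloring (Fin r)),
    (∀ i, n ≤ (c.colorClass i).ncard) ∧ G.maxDegree = Δ ∧
      ¬ ∃ S : Finset V, IsPartialIT G c (r + 1 - D) S}

open Classical in
/-- The set of minimum degrees of finite `r`-partite graphs with parts of size exactly `n` and without
a copy of the complete graph `K_t`. Its greatest element is the extremal function
`f(n, r, t)`. -/
def cliqueFreeMinDegrees (n r t : ℕ) : Set ℕ :=
  {δ | ∃ (V : Type) (_ : Fintype V) (G : SimpleGraph V) (c : G.Coloring (Fin r)),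
    (∀ i, (c.colorClass i).ncard = n) ∧ G.CliqueFree t ∧ G.minDegree = δ}

/-! Both formulas come from one inequality, `four_mul_le_five_mul_of_forall_card_ne_five`: six
classes of size at least `n`, maximum degree at most `Δ` and no 5-IT force `4n ≤ 5Δ`.

Suppose `4n > 5Δ`. From a maximum partial transversal `I`, with at most four vertices, stars are
grown: each centre lies in a class missed by `I` or containing an earlier leaf, is undominated by
earlier stars, and has its leaves in `I`. Taking leaf sets as small as possible makes an exchange
argument work, and counting dominated vertices allows four stars. Their leaf sets are disjoint and
nonempty, so they are singletons: the stars form an induced matching whose edges, read on the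
classes, form a forest with two components (`exists_inducedMatching_forest`).

One endpoint per edge, in distinct classes avoiding that of a vertex `v`, would with `v` give a 5-IT
if none were adjacent to `v`. Hence the eight endpoints dominate everything, and `6n + |R| ≤ 8Δ` for
the set `R` of vertices dominated at least twice. Vertices dominated once are so restricted that
`|R| ≥ 2(n - Δ)`, or else `R` contains a class; both contradict `4n > 5Δ`
(`four_mul_le_of_isSplitForest`).

Sharpness comes from `pairedGraph`, and the clique statement from complementing inside the complete
multipartite graph. -/

/-! ### Growing stars into an induced matching -/

section InducedMatching

open Finset

variable {V : Type*} (G : SimpleGraph V) [DecidableRel G.Adj]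

/-- Independent sets of size `m` meeting each colour class at most once, missing the classes in `Z`,
and having prescribed sets of neighbours `W 0, …, W (j - 1)` for the vertices `x 0, …, x (j - 1)`. -/
def IsAligned {K : Type*} [DecidableEq K] (c : V → K) (Z : Finset K) (m : ℕ) (x : ℕ → V)
    (W : ℕ → Finset V) (j : ℕ) (I : Finset V) : Prop :=
  G.IsIndepSet (I : Set V) ∧ Set.InjOn c (I : Set V) ∧ I.card = m ∧
    (∀ v ∈ I, c v ∉ Z) ∧ ∀ i < j, I.filter (G.Adj (x i)) = W i

/-- A sequence of stars with centres `x i` and leaf sets `W i ⊆ I`, grown from the classes in `Z`,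
each leaf set being as small as the earlier choices permit. -/
structure IsStarSequence {K : Type*} [DecidableEq K] (c : V → K) (Z : Finset K) (m : ℕ)
    (x : ℕ → V) (W : ℕ → Finset V) (j : ℕ) : Prop where
  exists_aligned : ∃ I, IsAligned G c Z m x W j I
  nonempty : ∀ i < j, (W i).Nonempty
  minimal : ∀ i < j, ∀ I, IsAligned G c Z m x W i I → (W i).card ≤ (I.filter (G.Adj (x i))).card
  color_mem : ∀ i < j, c (x i) ∈ Z ∨ ∃ k < i, ∃ w ∈ W k, c (x i) = c w
  not_adj : ∀ i < j, ∀ k < i, ¬ G.Adj (x i) (x k) ∧ ∀ w ∈ W k, ¬ G.Adj (x i) w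

variable {G} {K : Type*} [DecidableEq K] {c : V → K} {Z : Finset K} {m : ℕ} {x : ℕ → V}
  {W : ℕ → Finset V} {j : ℕ}

lemma SimpleGraph.IsIndepSet.insert {G : SimpleGraph V} {S : Set V} (hS : G.IsIndepSet S) {v : V}
    (hv : ∀ w ∈ S, ¬ G.Adj v w) : G.IsIndepSet (Insert.insert v S) := by
  rw [SimpleGraph.isIndepSet_iff, Set.pairwise_insert]
  exact ⟨hS, fun w hw _ => ⟨hv w hw, fun h => hv w hw h.symm⟩⟩

lemma SimpleGraph.IsIndepSet.subset {G : SimpleGraph V} {S T : Set V} (hS : G.IsIndepSet S)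
    (h : T ⊆ S) : G.IsIndepSet T :=
  Set.Pairwise.mono h hS

lemma IsAligned.congr {x' : ℕ → V} {W' : ℕ → Finset V} {I : Finset V}
    (h : IsAligned G c Z m x W j I) (hx : ∀ i < j, x' i = x i) (hW : ∀ i < j, W' i = W i) :
    IsAligned G c Z m x' W' j I := by
  refine ⟨h.1, h.2.1, h.2.2.1, h.2.2.2.1, fun i hi => ?_⟩
  rw [hx i hi, hW i hi]
  exact h.2.2.2.2 i hi

lemma IsStarSequence.disjoint (h : IsStarSequence G c Z m x W j) {i k : ℕ} (hi : i < j) (hk : k < j)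
    (hik : i ≠ k) : Disjoint (W i) (W k) := by
  obtain ⟨I, hI⟩ := h.exists_aligned
  have key : ∀ i < j, ∀ k < i, ∀ v ∈ W i, v ∉ W k := by
    intro i hi k hk v hv hv'
    rw [← hI.2.2.2.2 i hi, mem_filter] at hv
    exact (h.not_adj i hi k hk).2 v hv' hv.2
  rw [Finset.disjoint_left]
  intro v hv hv'
  rcases lt_or_gt_of_ne hik with hlt | hlt
  · exact key k hk i hlt v hv' hv
  · exact key i hi k hlt v hv hv'

variable [DecidableEq V]

/-- A vertex in a reached class which is not dominated by the stars has a neighbour in every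
aligned set. -/
lemma IsStarSequence.exists_adj (h : IsStarSequence G c Z m x W j)
    (hmax : ∀ S : Finset V, G.IsIndepSet (S : Set V) → Set.InjOn c (S : Set V) → S.card ≤ m)
    {I : Finset V} (hI : IsAligned G c Z m x W j I) {y : V}
    (hy : c y ∈ Z ∨ ∃ k < j, ∃ w ∈ W k, c y = c w)
    (hyx : ∀ k < j, ¬ G.Adj y (x k)) :
    (I.filter (G.Adj y)).Nonempty := by
  rw [Finset.nonempty_iff_ne_empty]
  intro hempty
  have hyI : ∀ v ∈ I, ¬ G.Adj y v := fun v hv hadj => by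
    have : v ∈ I.filter (G.Adj y) := mem_filter.2 ⟨hv, hadj⟩
    simp [hempty] at this
  obtain ⟨hind, hinj, hcard, hZ, hW⟩ := hI
  have hindep : ∀ J ⊆ I, G.IsIndepSet ((insert y J : Finset V) : Set V) := by
    intro J hJ
    rw [coe_insert]
    exact (hind.subset (coe_subset.2 hJ)).insert fun w hw => hyI w (hJ hw)
  have hinjOn : ∀ J ⊆ I, (∀ v ∈ J, c v ≠ c y) →
      Set.InjOn c ((insert y J : Finset V) : Set V) ∧ y ∉ J := by
    intro J hJ hne
    have hyJ : y ∉ J := fun hy => hne y hy rfl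
    refine ⟨?_, hyJ⟩
    rw [coe_insert, Set.injOn_insert (by simpa using hyJ)]
    refine ⟨hinj.mono (coe_subset.2 hJ), ?_⟩
    rintro ⟨v, hv, hvy⟩
    exact hne v hv hvy
  -- In a missed class, `y` would enlarge `I`. In the class of a leaf `w` of star `i`, exchanging
  -- `w` for `y` keeps the earlier leaf sets and removes a neighbour of `x i`, against minimality.
  rcases hy with hy | ⟨i, hi, w, hw, hyw⟩
  · obtain ⟨h1, h2⟩ := hinjOn I subset_rfl fun v hv hvy => hZ v hv (hvy ▸ hy)
    have := hmax _ (hindep I subset_rfl) h1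
    rw [card_insert_of_notMem h2] at this
    omega
  · have hwI : w ∈ I ∧ G.Adj (x i) w := by rwa [← hW i hi, mem_filter] at hw
    obtain ⟨h1, h2⟩ := hinjOn (I.erase w) (erase_subset _ _) fun v hv hvy => by
      rw [mem_erase] at hv
      exact hv.1 (hinj hv.2 hwI.1 (hvy.trans hyw))
    have hal : IsAligned G c Z m x W i (insert y (I.erase w)) := by
      refine ⟨hindep _ (erase_subset _ _), h1, ?_, ?_, ?_⟩
      · rw [card_insert_of_notMem h2, card_erase_add_one hwI.1, hcard]
      · intro v hv
        rcases mem_insert.1 hv with rfl | hv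
        · rw [hyw]
          exact hZ w hwI.1
        · exact hZ v (mem_of_mem_erase hv)
      · intro k hk
        have hwk : w ∉ I.filter (G.Adj (x k)) := by
          rw [hW k (hk.trans hi)]
          exact Finset.disjoint_left.1 (h.disjoint hi (hk.trans hi) hk.ne') hw
        rw [filter_insert, if_neg fun h => hyx k (hk.trans hi) h.symm, filter_erase,
          erase_eq_of_notMem hwk, hW k (hk.trans hi)]
    have hle := h.minimal i hi _ hal
    rw [filter_insert, if_neg fun h => hyx i hi h.symm, filter_erase, hW i hi] at hle
    exact absurd hle (card_erase_lt_of_mem hw).not_ge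

/-- A star sequence can be prolonged by any undominated vertex in a reached class. -/
lemma IsStarSequence.exists_succ [Fintype V] (h : IsStarSequence G c Z m x W j)
    (hmax : ∀ S : Finset V, G.IsIndepSet (S : Set V) → Set.InjOn c (S : Set V) → S.card ≤ m)
    {y : V} (hy : c y ∈ Z ∨ ∃ k < j, ∃ w ∈ W k, c y = c w)
    (hyx : ∀ k < j, ¬ G.Adj y (x k) ∧ ∀ w ∈ W k, ¬ G.Adj y w) :
    ∃ x' W', IsStarSequence G c Z m x' W' (j + 1) := by
  classical
  obtain ⟨I, hI, hImin⟩ := exists_min_image (univ.filter fun I => IsAligned G c Z m x W j I)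
    (fun I => (I.filter (G.Adj y)).card) (by
      obtain ⟨I, hI⟩ := h.exists_aligned
      exact ⟨I, by simpa using hI⟩)
  rw [mem_filter] at hI
  have hI := hI.2
  set x' := Function.update x j y with hx'
  set W' := Function.update W j (I.filter (G.Adj y)) with hW'
  have hxj : x' j = y := Function.update_self ..
  have hWj : W' j = I.filter (G.Adj y) := Function.update_self ..
  have hxi : ∀ i < j, x' i = x i := fun i hi => Function.update_of_ne hi.ne _ _
  have hWi : ∀ i < j, W' i = W i := fun i hi => Function.update_of_ne hi.ne _ _
  refine ⟨x', W', ⟨I, ?_⟩, ?_, ?_, ?_, ?_⟩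
  · obtain ⟨h1, h2, h3, h4, h5⟩ := hI.congr hxi hWi
    refine ⟨h1, h2, h3, h4, fun i hi => ?_⟩
    rcases Nat.lt_succ_iff_lt_or_eq.1 hi with hi | rfl
    · exact h5 i hi
    · rw [hxj, hWj]
  · intro i hi
    rcases Nat.lt_succ_iff_lt_or_eq.1 hi with hi | rfl
    · rw [hWi i hi]
      exact h.nonempty i hi
    · rw [hWj]
      exact h.exists_adj hmax hI hy fun k hk => (hyx k hk).1
  · intro i hi J hJ
    rcases Nat.lt_succ_iff_lt_or_eq.1 hi with hi | rfl
    · rw [hWi i hi, hxi i hi]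
      exact h.minimal i hi J (hJ.congr (fun k hk => (hxi k (hk.trans hi)).symm)
        fun k hk => (hWi k (hk.trans hi)).symm)
    · rw [hWj, hxj]
      exact hImin J (mem_filter.2 ⟨mem_univ _,
        hJ.congr (fun k hk => (hxi k hk).symm) fun k hk => (hWi k hk).symm⟩)
  · intro i hi
    rcases Nat.lt_succ_iff_lt_or_eq.1 hi with hi | rfl
    · rw [hxi i hi]
      refine (h.color_mem i hi).imp_right ?_
      rintro ⟨k, hk, w, hw, e⟩
      exact ⟨k, hk, w, by rwa [hWi k (hk.trans hi)], e⟩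
    · rw [hxj]
      refine hy.imp_right ?_
      rintro ⟨k, hk, w, hw, e⟩
      exact ⟨k, hk, w, by rwa [hWi k hk], e⟩
  · intro i hi k hk
    rcases Nat.lt_succ_iff_lt_or_eq.1 hi with hi | rfl
    · rw [hxi i hi, hxi k (hk.trans hi), hWi k (hk.trans hi)]
      exact h.not_adj i hi k hk
    · rw [hxj, hxi k hk, hWi k hk]
      exact hyx k hk

lemma card_le_mul_of_dominated [Fintype V] {Δ : ℕ} (hΔ : ∀ v, G.degree v ≤ Δ) {S D : Finset V}
    (h : ∀ v ∈ S, ∃ u ∈ D, G.Adj u v) : S.card ≤ D.card * Δ := by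
  have hsub : S ⊆ D.biUnion fun u => G.neighborFinset u := fun v hv => by
    obtain ⟨u, hu, huv⟩ := h v hv
    exact mem_biUnion.2 ⟨u, hu, by simpa using huv⟩
  exact (card_le_card hsub).trans (card_biUnion_le_card_mul _ _ _ fun u _ => hΔ u)

lemma card_mul_le_card_filter_mem [Fintype V] {n : ℕ} (hn : ∀ i, n ≤ (univ.filter (c · = i)).card)
    (T : Finset K) : T.card * n ≤ (univ.filter (c · ∈ T)).card := by
  have : univ.filter (c · ∈ T) = T.biUnion fun i => univ.filter (c · = i) := by
    ext v
    simp
  rw [this, card_biUnion]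
  · rw [← smul_eq_mul]
    exact card_nsmul_le_sum _ _ _ fun i _ => hn i
  · intro i _ k _ hik
    rw [Function.onFun, Finset.disjoint_left]
    intro v hv hv'
    simp only [mem_filter, mem_univ, true_and] at hv hv'
    exact hik (hv.symm.trans hv')

lemma IsStarSequence.card_biUnion (h : IsStarSequence G c Z m x W j) :
    ((range j).biUnion W).card = ∑ i ∈ range j, (W i).card :=
  Finset.card_biUnion fun _ hi _ hk hik => h.disjoint (mem_range.1 hi) (mem_range.1 hk) hik

lemma IsStarSequence.le_card_biUnion (h : IsStarSequence G c Z m x W j) :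
    j ≤ ((range j).biUnion W).card := by
  rw [h.card_biUnion]
  simpa using card_nsmul_le_sum (range j) (fun i => (W i).card) 1
    fun i hi => (h.nonempty i (mem_range.1 hi)).card_pos

lemma IsAligned.biUnion_subset {I : Finset V} (hI : IsAligned G c Z m x W j I) :
    (range j).biUnion W ⊆ I := by
  refine Finset.biUnion_subset.2 fun i hi => ?_
  rw [← hI.2.2.2.2 i (mem_range.1 hi)]
  exact filter_subset _ _

lemma IsAligned.card_biUnion_le {I : Finset V} (hI : IsAligned G c Z m x W j I) :
    ((range j).biUnion W).card ≤ m :=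
  (card_le_card hI.biUnion_subset).trans hI.2.2.1.le

/-- With six classes of more than `5 Δ / 4` vertices, there is an undominated vertex in a reached
class as long as there are at most three stars. -/
lemma IsStarSequence.exists_undominated [Fintype V] {c : V → Fin 6} {Z : Finset (Fin 6)}
    {n Δ : ℕ} (h : IsStarSequence G c Z m x W j) (hΔ : ∀ v, G.degree v ≤ Δ)
    (hn : ∀ i, n ≤ (univ.filter (c · = i)).card) (hlt : 5 * Δ < 4 * n)
    (hZ : Z.card = 6 - m) (hm : m ≤ 4) (hj : j < 4) :
    ∃ y, (c y ∈ Z ∨ ∃ k < j, ∃ w ∈ W k, c y = c w) ∧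
      ∀ k < j, ¬ G.Adj y (x k) ∧ ∀ w ∈ W k, ¬ G.Adj y w := by
  by_contra! hcon
  obtain ⟨I, hI⟩ := h.exists_aligned
  set U := (range j).biUnion W with hU
  have hUI : U ⊆ I := hI.biUnion_subset
  have hUm : U.card ≤ m := hI.card_biUnion_le
  have hjU : j ≤ U.card := h.le_card_biUnion
  have hS : (Z ∪ U.image c).card = 6 - m + U.card := by
    rw [card_union_of_disjoint, hZ, card_image_of_injOn (hI.2.1.mono (coe_subset.2 hUI))]
    rw [Finset.disjoint_right]
    intro i hi
    obtain ⟨v, hv, rfl⟩ := mem_image.1 hi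
    exact hI.2.2.2.1 v (hUI hv)
  have hD : ((range j).image x ∪ U).card ≤ j + U.card :=
    (card_union_le _ _).trans (Nat.add_le_add_right (card_image_le.trans (card_range j).le) _)
  have hdom : ∀ v ∈ univ.filter (c · ∈ Z ∪ U.image c),
      ∃ u ∈ (range j).image x ∪ U, G.Adj u v := by
    intro v hv
    have hv' : c v ∈ Z ∨ ∃ k < j, ∃ w ∈ W k, c v = c w := by
      rw [mem_filter, mem_union] at hv
      refine hv.2.imp_right fun hv => ?_
      obtain ⟨w, hw, e⟩ := mem_image.1 hv
      obtain ⟨k, hk, hwk⟩ := mem_biUnion.1 hw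
      exact ⟨k, mem_range.1 hk, w, hwk, e.symm⟩
    obtain ⟨k, hk, hadj⟩ := hcon v hv'
    by_cases hvk : G.Adj v (x k)
    · exact ⟨x k, mem_union_left _ (mem_image_of_mem _ (mem_range.2 hk)), hvk.symm⟩
    · obtain ⟨w, hw, hvw⟩ := hadj hvk
      exact ⟨w, mem_union_right _ (mem_biUnion.2 ⟨k, mem_range.2 hk, hw⟩), hvw.symm⟩
  have h1 := card_le_mul_of_dominated hΔ hdom
  have h2 := card_mul_le_card_filter_mem hn (Z ∪ U.image c)
  rw [hS] at h2
  -- For `j ≤ 3` and `j ≤ s ≤ m ≤ 4` the ratio `(j + s) / (6 - m + s)` is at most `6/5`, attained at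
  -- `j = s = 3`, `m = 4`, hence below `5/4`. At `j = s = m = 4` it would be `4/3`.
  have h3 : (6 - m + U.card) * n ≤ (j + U.card) * Δ :=
    h2.trans (h1.trans (Nat.mul_le_mul_right _ hD))
  generalize U.card = s at *
  interval_cases m <;> interval_cases s <;> interval_cases j <;> omega

/-- If six classes have more than `5 Δ / 4` vertices each and there is no independent transversal of
five of them, then there is an induced matching of four edges forming a forest with two
components on the classes. -/
theorem exists_inducedMatching_forest [Fintype V] {c : V → Fin 6} {n Δ : ℕ}
    (hΔ : ∀ v, G.degree v ≤ Δ) (hn : ∀ i, n ≤ (univ.filter (c · = i)).card) (hlt : 5 * Δ < 4 * n)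
    (hno : ∀ S : Finset V, G.IsIndepSet (S : Set V) → Set.InjOn c (S : Set V) → S.card ≠ 5) :
    ∃ (x w : Fin 4 → V) (Z : Finset (Fin 6)), Z.card = 2 ∧ Function.Injective (c ∘ w) ∧
      (∀ i, c (w i) ∉ Z) ∧ (∀ i, c (x i) ∈ Z ∨ ∃ k < i, c (x i) = c (w k)) ∧
      ∀ i k, i ≠ k → ¬ G.Adj (x i) (x k) ∧ ¬ G.Adj (x i) (w k) ∧ ¬ G.Adj (w i) (w k) := by
  classical
  obtain ⟨I, hI, hImax⟩ := exists_max_image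
    (univ.filter fun S : Finset V => G.IsIndepSet (S : Set V) ∧ Set.InjOn c (S : Set V)) card
    ⟨∅, by simp [SimpleGraph.isIndepSet_iff]⟩
  simp only [mem_filter, mem_univ, true_and, and_imp] at hI hImax
  have hI4 : I.card ≤ 4 := by
    by_contra! h5
    obtain ⟨S, hSI, hS⟩ := exists_subset_card_eq (show 5 ≤ I.card from h5)
    exact hno S (hI.1.subset (coe_subset.2 hSI)) (hI.2.mono (coe_subset.2 hSI)) hS
  set Z := univ \ I.image c with hZdef
  have hZ : Z.card = 6 - I.card := by
    rw [hZdef, card_sdiff_of_subset (subset_univ _), card_image_of_injOn hI.2, card_univ,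
      Fintype.card_fin]
  have hZI : ∀ v ∈ I, c v ∉ Z := fun v hv => by simp [hZdef]; exact ⟨v, hv, rfl⟩
  obtain ⟨v₀⟩ : Nonempty V := by
    by_contra hV
    rw [not_nonempty_iff] at hV
    have := hn 0
    simp at this
    omega
  have hseq : ∀ j ≤ 4, ∃ x W, IsStarSequence G c Z I.card x W j := by
    intro j
    induction j with
    | zero =>
      intro _
      exact ⟨fun _ => v₀, fun _ => ∅, ⟨I, hI.1, hI.2, rfl, hZI, by simp⟩, by simp, by simp,
        by simp, by simp⟩
    | succ j ih =>
      intro hj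
      obtain ⟨x, W, h⟩ := ih (by omega)
      obtain ⟨y, hy, hyx⟩ := h.exists_undominated hΔ hn hlt hZ hI4 hj
      exact h.exists_succ hImax hy hyx
  obtain ⟨x, W, h⟩ := hseq 4 le_rfl
  obtain ⟨J, hJ⟩ := h.exists_aligned
  have hle := h.le_card_biUnion
  have hle' := hJ.card_biUnion_le
  -- Four disjoint nonempty leaf sets inside a set of at most four vertices leave one leaf per star.
  have hm : I.card = 4 := le_antisymm hI4 (hle.trans hle')
  have hsum := h.card_biUnion
  have hW1 : ∀ i < 4, (W i).card = 1 := by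
    have hpos : ∀ i < 4, 0 < (W i).card := fun i hi => (h.nonempty i hi).card_pos
    simp only [sum_range_succ, sum_range_zero] at hsum
    have := hpos 0 (by omega)
    have := hpos 1 (by omega)
    have := hpos 2 (by omega)
    have := hpos 3 (by omega)
    intro i hi
    interval_cases i <;> omega
  have hw : ∀ i : Fin 4, ∃ w, W i = {w} := fun i => card_eq_one.1 (hW1 i i.2)
  choose w hw using hw
  have hwJ : ∀ i, w i ∈ J ∧ G.Adj (x i) (w i) := by
    intro i
    rw [← mem_filter, hJ.2.2.2.2 i i.2, hw i]
    exact mem_singleton_self _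
  have hwinj : Function.Injective w := by
    intro i k hik
    by_contra hne
    have := h.disjoint i.2 k.2 (Fin.val_ne_of_ne hne)
    rw [hw i, hw k, hik] at this
    simp at this
  have hxw : ∀ i k : Fin 4, i ≠ k → ¬ G.Adj (x i) (w k) := by
    intro i k hik hadj
    have : w k ∈ W i := by
      rw [← hJ.2.2.2.2 i i.2]
      exact mem_filter.2 ⟨(hwJ k).1, hadj⟩
    rw [hw i, mem_singleton] at this
    exact hik (hwinj this).symm
  refine ⟨fun i => x i, w, Z, by rw [hZ, hm], ?_, fun i => hJ.2.2.2.1 _ (hwJ i).1, ?_, ?_⟩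
  · exact fun i k hik => hwinj (hJ.2.1 (hwJ i).1 (hwJ k).1 hik)
  · intro i
    refine (h.color_mem i i.2).imp_right ?_
    rintro ⟨k, hk, v, hv, e⟩
    rw [hw ⟨k, hk.trans i.2⟩, mem_singleton] at hv
    exact ⟨⟨k, hk.trans i.2⟩, hk, by rw [e, hv]⟩
  · intro i k hik
    refine ⟨?_, hxw i k hik, hJ.1 (hwJ i).1 (hwJ k).1 fun e => hik (hwinj e)⟩
    rcases lt_or_gt_of_ne hik with hlt | hlt
    · exact fun hadj => (h.not_adj k k.2 i hlt).1 hadj.symm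
    · exact (h.not_adj i i.2 k hlt).1

end InducedMatching

/-! ### Choosing endpoints in forests on six classes -/

section ForestChoice

/-- From each pair of a list one entry can be chosen so that the chosen entries are distinct and do
not occur in `used`. -/
def HasChoice {α : Type*} : List (α × α) → List α → Prop
  | [], _ => True
  | (a, b) :: es, used =>
    (a ∉ used ∧ HasChoice es (a :: used)) ∨ (b ∉ used ∧ HasChoice es (b :: used))

instance HasChoice.decidable {α : Type*} [DecidableEq α] :
    ∀ (es : List (α × α)) (used : List α), Decidable (HasChoice es used)
  | [], _ => isTrue trivial
  | (a, b) :: es, used =>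
    have := HasChoice.decidable es (a :: used)
    have := HasChoice.decidable es (b :: used)
    inferInstanceAs (Decidable ((a ∉ used ∧ HasChoice es (a :: used)) ∨
      (b ∉ used ∧ HasChoice es (b :: used))))

/-- The pairs of endpoints of the edges in `l`, where the endpoint `b` of the edge `i` is replaced by
the other one. -/
def endPairs {α : Type*} (f : Fin 4 → Bool → α) (i : Fin 4) (b : Bool) (l : List (Fin 4)) :
    List (α × α) :=
  l.map fun j => if j = i then (f j !b, f j !b) else (f j false, f j true)

/-- The endpoints of the edges of a rooted forest with vertex set `Fin 6` and roots `0` and `1`, whose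
`i`-th edge joins the vertex `i + 2` to its parent `par i`. -/
def forestEnd (par : Fin 4 → Fin 6) (i : Fin 4) (b : Bool) : Fin 6 :=
  if b then i.succ.succ else par i

/-- The edges have distinct endpoints other than `r`, avoiding the endpoint `b` of the edge `i`. -/
abbrev Avoids (f : Fin 4 → Bool → Fin 6) (r : Fin 6) (i : Fin 4) (b : Bool) : Prop :=
  HasChoice (endPairs f i b [0, 1, 2, 3]) [r]

/-- Every endpoint other than the endpoint `b` of the edge `j` can be avoided by a choice of endpoints
other than `r`. -/
def OneSided (f : Fin 4 → Bool → Fin 6) (r : Fin 6) (j : Fin 4) (b : Bool) : Prop :=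
  ∀ i a, (i = j ∧ a = b) ∨ Avoids f r i a

instance (f r j b) : Decidable (OneSided f r j b) :=
  inferInstanceAs (Decidable (∀ i a, (i = j ∧ a = b) ∨ Avoids f r i a))

/-- The choices available at the two end classes of a component of the forest which is a path formed
by the edges `j` and `k`, the centre being the endpoint `b` of `j`. -/
def IsPathComponent (f : Fin 4 → Bool → Fin 6) (j : Fin 4) (b : Bool) (k : Fin 4) : Prop :=
  (∀ i a, (i = j ∧ a = b) ∨ (i = k ∧ a = true) ∨ Avoids f (f j !b) i a) ∧
    ∀ i a, Avoids f (f k true) i a ∨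
      HasChoice (endPairs f i a ([0, 1, 2, 3].filter (· ≠ k))) [f j !b, f k true]

instance (f j b k) : Decidable (IsPathComponent f j b k) :=
  inferInstanceAs (Decidable ((∀ i a, (i = j ∧ a = b) ∨ (i = k ∧ a = true) ∨ Avoids f (f j !b) i a) ∧
    ∀ i a, Avoids f (f k true) i a ∨
      HasChoice (endPairs f i a ([0, 1, 2, 3].filter (· ≠ k))) [f j !b, f k true]))

/-- The choices available in a forest with two components on six vertices: it has a component with two
vertices, or two components which are paths with three vertices, or an isolated vertex. -/
def IsSplitForest (f : Fin 4 → Bool → Fin 6) : Prop :=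
  (∀ r, ∃ b, Avoids f r 0 b) ∧
    ((∃ i, f i false ≠ f i true ∧ OneSided f (f i false) i true ∧ OneSided f (f i true) i false) ∨
      (∃ k j b, j < k ∧ f j b = f k false ∧ f j (!b) ≠ f k true ∧ IsPathComponent f j b k ∧
        ∃ k' j' b', j' < k' ∧ f j' b' = f k' false ∧ f j' (!b') ≠ f k' true ∧
          (f j (!b) ≠ f j' (!b') ∧ f j (!b) ≠ f k' true ∧ f k true ≠ f j' (!b') ∧
            f k true ≠ f k' true) ∧ IsPathComponent f j' b' k') ∨
      ∃ r, ∀ i b, Avoids f r i b)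

instance (f) : Decidable (IsSplitForest f) := by
  unfold IsSplitForest
  infer_instance

/-- The component sizes 2+4, 3+3 and 1+5 match the three alternatives. Orienting a tree away from a
vertex chooses distinct endpoints missing that vertex. Only the component of `r` has its orientation
forced; the other may be rooted so as to avoid any given endpoint. There are `2 · 3 · 4 · 5` parent
functions to check. -/
lemma isSplitForest_of_fin : ∀ (p₀ : Fin 2) (p₁ : Fin 3) (p₂ : Fin 4) (p₃ : Fin 5),
    IsSplitForest (forestEnd ![p₀.castLE (by decide), p₁.castLE (by decide), p₂.castLE (by decide),
      p₃.castLE (by decide)]) := by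
  decide +kernel

lemma isSplitForest {par : Fin 4 → Fin 6} (h : ∀ i : Fin 4, (par i : ℕ) < i + 2) :
    IsSplitForest (forestEnd par) := by
  convert isSplitForest_of_fin ⟨par 0, h 0⟩ ⟨par 1, h 1⟩ ⟨par 2, h 2⟩ ⟨par 3, h 3⟩ using 2
  funext i
  fin_cases i <;> rfl

lemma exists_of_mem_endPairs {α : Type*} {f : Fin 4 → Bool → α} {i : Fin 4} {b : Bool}
    {l : List (Fin 4)} {e : α × α} (he : e ∈ endPairs f i b l) :
    ∃ j ∈ l, ∃ b₁ b₂, e = (f j b₁, f j b₂) ∧ ¬ (j = i ∧ b₁ = b) ∧ ¬ (j = i ∧ b₂ = b) := by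
  obtain ⟨j, hj, rfl⟩ := List.mem_map.1 he
  refine ⟨j, hj, ?_⟩
  split_ifs with h
  · exact ⟨!b, !b, rfl, by simp, by simp⟩
  · exact ⟨false, true, rfl, by simp [h], by simp [h]⟩

lemma map_endPairs {α β : Type*} (d : α → β) (f : Fin 4 → Bool → α) (i : Fin 4) (b : Bool)
    (l : List (Fin 4)) :
    (endPairs f i b l).map (Prod.map d d) = endPairs (fun i b => d (f i b)) i b l := by
  simp only [endPairs, List.map_map]
  refine List.map_congr_left fun j _ => ?_
  simp only [Function.comp]
  split_ifs <;> rfl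

end ForestChoice

/-! ### From the induced matching to the inequality -/

section ForestMatching

open Finset

variable {V : Type*} {G : SimpleGraph V} {d : V → Fin 6} {p : Fin 4 → Bool → V}

lemma pairwise_endPairs (hp : ∀ i k, i ≠ k → ∀ a b, ¬ G.Adj (p i a) (p k b)) (i : Fin 4) (b : Bool)
    {l : List (Fin 4)} (hl : l.Nodup) :
    (endPairs p i b l).Pairwise (fun e e' => ¬ G.Adj e.1 e'.1 ∧ ¬ G.Adj e.1 e'.2 ∧
      ¬ G.Adj e.2 e'.1 ∧ ¬ G.Adj e.2 e'.2) := by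
  rw [endPairs, List.pairwise_map]
  refine hl.imp fun {j k} hjk => ?_
  split_ifs <;> exact ⟨hp _ _ hjk _ _, hp _ _ hjk _ _, hp _ _ hjk _ _, hp _ _ hjk _ _⟩

lemma card_filter_add_card_filter_le [DecidableEq V] {r s : Fin 6} (h : r ≠ s) (R : Finset V) :
    (R.filter (d · = r)).card + (R.filter (d · = s)).card ≤ R.card := by
  rw [← card_union_of_disjoint]
  · exact card_le_card (union_subset (filter_subset _ _) (filter_subset _ _))
  · rw [Finset.disjoint_left]
    intro v hv hv'
    exact h ((mem_filter.1 hv).2.symm.trans (mem_filter.1 hv').2)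

/-- The vertices with at least two neighbours among the endpoints `p i b`. -/
def multiplyDominated [Fintype V] (G : SimpleGraph V) [DecidableRel G.Adj]
    (p : Fin 4 → Bool → V) : Finset V :=
  univ.filter fun v => 2 ≤ (univ.filter fun u : Fin 4 × Bool => G.Adj v (p u.1 u.2)).card

lemma exists_unique_neighbor [Fintype V] [DecidableRel G.Adj]
    (hdom : ∀ v, ∃ i b, G.Adj v (p i b)) {v : V} (hv : v ∉ multiplyDominated G p) :
    ∃ i b, G.Adj v (p i b) ∧ ∀ k a, G.Adj v (p k a) → k = i ∧ a = b := by
  simp only [multiplyDominated, mem_filter, mem_univ, true_and, not_le] at hv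
  obtain ⟨⟨i, b⟩, hu⟩ := card_le_one_iff_subset_singleton.1 (Nat.le_of_lt_succ hv)
  have hv : ∀ k a, G.Adj v (p k a) → k = i ∧ a = b := fun k a hadj => by
    have : (k, a) ∈ ({(i, b)} : Finset (Fin 4 × Bool)) := hu (by simpa using hadj)
    simpa using this
  obtain ⟨k, a, hadj⟩ := hdom v
  obtain ⟨rfl, rfl⟩ := hv k a hadj
  exact ⟨k, a, hadj, hv⟩

variable [DecidableEq V]

/-- Turns a choice of classes into a transversal: the chosen endpoints are added to `S` one by one,
`used` recording the occupied classes. -/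
lemma HasChoice.exists_isIndepSet {K : Type*} {d : V → K} : ∀ {es : List (V × V)} {used : List K},
    HasChoice (es.map (Prod.map d d)) used →
    es.Pairwise (fun e e' => ¬ G.Adj e.1 e'.1 ∧ ¬ G.Adj e.1 e'.2 ∧ ¬ G.Adj e.2 e'.1 ∧
      ¬ G.Adj e.2 e'.2) →
    ∀ S : Finset V, G.IsIndepSet (S : Set V) → Set.InjOn d (S : Set V) → (∀ v ∈ S, d v ∈ used) →
      (∀ e ∈ es, ∀ v ∈ S, ¬ G.Adj e.1 v ∧ ¬ G.Adj e.2 v) →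
      ∃ T : Finset V, G.IsIndepSet (T : Set V) ∧ Set.InjOn d (T : Set V) ∧
        T.card = S.card + es.length := by
  intro es
  induction es with
  | nil => exact fun _ _ S h1 h2 _ _ => ⟨S, h1, h2, rfl⟩
  | cons e es ih =>
    intro used hch hpw S h1 h2 h3 h4
    rw [List.pairwise_cons] at hpw
    have step : ∀ a : V, d a ∉ used → HasChoice (es.map (Prod.map d d)) (d a :: used) →
        (∀ v ∈ S, ¬ G.Adj a v) → (∀ e' ∈ es, ¬ G.Adj a e'.1 ∧ ¬ G.Adj a e'.2) →
        ∃ T : Finset V, G.IsIndepSet (T : Set V) ∧ Set.InjOn d (T : Set V) ∧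
          T.card = S.card + (e :: es).length := by
      intro a ha hch haS hae
      have haS' : a ∉ S := fun h => ha (h3 a h)
      obtain ⟨T, hT1, hT2, hT3⟩ := ih hch hpw.2 (insert a S)
        (by rw [coe_insert]; exact h1.insert haS)
        (by
          rw [coe_insert, Set.injOn_insert (by simpa using haS')]
          refine ⟨h2, ?_⟩
          rintro ⟨v, hv, hva⟩
          exact ha (hva ▸ h3 v hv))
        (by
          intro v hv
          rcases mem_insert.1 hv with rfl | hv
          · exact List.mem_cons_self
          · exact List.mem_cons_of_mem _ (h3 v hv))
        (by
          intro e' he' v hv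
          rcases mem_insert.1 hv with rfl | hv
          · exact ⟨fun h => (hae e' he').1 h.symm, fun h => (hae e' he').2 h.symm⟩
          · exact h4 e' (List.mem_cons_of_mem _ he') v hv)
      refine ⟨T, hT1, hT2, ?_⟩
      rw [hT3, card_insert_of_notMem haS', List.length_cons]
      omega
    have he := h4 e List.mem_cons_self
    rcases hch with ⟨ha, hch⟩ | ⟨ha, hch⟩
    · exact step e.1 ha hch (fun v hv => (he v hv).1)
        fun e' he' => ⟨(hpw.1 e' he').1, (hpw.1 e' he').2.1⟩
    · exact step e.2 ha hch (fun v hv => (he v hv).2)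
        fun e' he' => (hpw.1 e' he').2.2

/-- A vertex with only one neighbour in an induced matching cannot be completed to a transversal. -/
lemma not_avoids (hp : ∀ i k, i ≠ k → ∀ a b, ¬ G.Adj (p i a) (p k b))
    (hno : ∀ S : Finset V, G.IsIndepSet (S : Set V) → Set.InjOn d (S : Set V) → S.card ≠ 5)
    {v : V} {i : Fin 4} {b : Bool} (hv : ∀ k a, G.Adj v (p k a) → k = i ∧ a = b) :
    ¬ Avoids (fun i b => d (p i b)) (d v) i b := by
  intro h
  rw [Avoids, ← map_endPairs d p] at h
  obtain ⟨T, h1, h2, h3⟩ := h.exists_isIndepSet (pairwise_endPairs hp i b (by decide)) {v}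
    (by simp [SimpleGraph.isIndepSet_iff]) (by simp) (by simp) (by
      intro e he u hu
      rw [mem_singleton] at hu
      obtain ⟨j, -, b₁, b₂, rfl, hb₁, hb₂⟩ := exists_of_mem_endPairs he
      exact ⟨fun hadj => hb₁ (hv _ _ (hu ▸ hadj.symm)), fun hadj => hb₂ (hv _ _ (hu ▸ hadj.symm))⟩)
  exact hno T h1 h2 (by rw [h3]; simp [endPairs])

/-- Here `s` takes the place of the edge `k`, the only edge it can meet: `s`, `v` and endpoints of
the other three edges would form a 5-IT. -/
lemma not_hasChoice_of_not_adj (hp : ∀ i k, i ≠ k → ∀ a b, ¬ G.Adj (p i a) (p k b))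
    (hno : ∀ S : Finset V, G.IsIndepSet (S : Set V) → Set.InjOn d (S : Set V) → S.card ≠ 5)
    {v : V} {i : Fin 4} {b : Bool} (hv : ∀ k a, G.Adj v (p k a) → k = i ∧ a = b)
    {s : V} {k : Fin 4} (hs : ∀ j a, G.Adj s (p j a) → j = k) (hsv : ¬ G.Adj s v)
    (hd : d s ≠ d v) :
    ¬ HasChoice (endPairs (fun i b => d (p i b)) i b ([0, 1, 2, 3].filter (· ≠ k)))
      [d s, d v] := by
  intro h
  rw [← map_endPairs d p] at h
  have hne : s ≠ v := fun e => hd (congrArg d e)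
  obtain ⟨T, h1, h2, h3⟩ := h.exists_isIndepSet
    (pairwise_endPairs hp i b (List.Nodup.filter _ (by decide))) {s, v}
    (by
      rw [coe_insert, coe_singleton]
      exact SimpleGraph.IsIndepSet.insert (by simp [SimpleGraph.isIndepSet_iff]) (by simpa using hsv))
    (by
      rw [coe_insert, coe_singleton, Set.injOn_insert (by simpa using hne)]
      simpa using hd)
    (by simp) (by
      intro e he u hu
      obtain ⟨j, hj, b₁, b₂, rfl, hb₁, hb₂⟩ := exists_of_mem_endPairs he
      have hjk : j ≠ k := by simpa using (List.mem_filter.1 hj).2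
      rcases mem_insert.1 hu with rfl | hu
      · exact ⟨fun hadj => hjk (hs _ _ hadj.symm), fun hadj => hjk (hs _ _ hadj.symm)⟩
      · rw [mem_singleton] at hu
        exact ⟨fun hadj => hb₁ (hv _ _ (hu ▸ hadj.symm)),
          fun hadj => hb₂ (hv _ _ (hu ▸ hadj.symm))⟩)
  refine hno T h1 h2 ?_
  have hlen : ∀ k : Fin 4, ([0, 1, 2, 3].filter (· ≠ k) : List (Fin 4)).length = 3 := by decide
  rw [h3, card_pair hne, endPairs, List.length_map, hlen]

variable [Fintype V] [DecidableRel G.Adj] {n Δ : ℕ}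

lemma le_card_multiplyDominated_of_dominated (hΔ : ∀ v, G.degree v ≤ Δ)
    (hn : ∀ i, n ≤ (univ.filter (d · = i)).card) {r : Fin 6} {u : V}
    (h : ∀ v, d v = r → v ∉ multiplyDominated G p → G.Adj u v) :
    n ≤ ((multiplyDominated G p).filter (d · = r)).card + Δ := by
  have hsub : univ.filter (d · = r) ⊆
      (multiplyDominated G p).filter (d · = r) ∪ G.neighborFinset u := by
    intro v hv
    rw [mem_filter] at hv
    by_cases hvR : v ∈ multiplyDominated G p
    · exact mem_union_left _ (mem_filter.2 ⟨hvR, hv.2⟩)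
    · exact mem_union_right _ (by simpa using h v hv.2 hvR)
  exact (hn r).trans ((card_le_card hsub).trans ((card_union_le _ _).trans
    (Nat.add_le_add_left (hΔ u) _)))

/-- Double counting of adjacencies with the eight endpoints: every vertex counts at least once,
those in `multiplyDominated G p` at least twice. -/
lemma six_mul_add_card_multiplyDominated_le (hΔ : ∀ v, G.degree v ≤ Δ)
    (hn : ∀ i, n ≤ (univ.filter (d · = i)).card) (hdom : ∀ v, ∃ i b, G.Adj v (p i b)) :
    6 * n + (multiplyDominated G p).card ≤ 8 * Δ := by
  have h6 : 6 * n ≤ Fintype.card V := by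
    simpa using card_mul_le_card_filter_mem hn univ
  have hsum : ∑ v, (univ.filter fun u : Fin 4 × Bool => G.Adj v (p u.1 u.2)).card ≤ 8 * Δ := by
    have := sum_card_bipartiteAbove_eq_sum_card_bipartiteBelow (s := univ) (t := univ)
      (fun (v : V) (u : Fin 4 × Bool) => G.Adj v (p u.1 u.2))
    simp only [bipartiteAbove, bipartiteBelow] at this
    rw [this]
    refine (sum_le_card_nsmul _ _ Δ fun u _ => ?_).trans (by simp)
    refine le_trans (card_le_card fun v hv => ?_) (hΔ (p u.1 u.2))
    simpa [G.adj_comm] using hv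
  have hlow : Fintype.card V + (multiplyDominated G p).card ≤
      ∑ v, (univ.filter fun u : Fin 4 × Bool => G.Adj v (p u.1 u.2)).card := by
    rw [multiplyDominated, card_filter, ← card_univ, card_eq_sum_ones, ← sum_add_distrib]
    refine sum_le_sum fun v _ => ?_
    obtain ⟨i, b, hadj⟩ := hdom v
    have : 0 < (univ.filter fun u : Fin 4 × Bool => G.Adj v (p u.1 u.2)).card :=
      card_pos.2 ⟨(i, b), by simpa using hadj⟩
    split_ifs <;> omega
  omega

/-- A singly dominated vertex of the first end class sees only the centre `p j b` or the far end `p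
k true`. If none sees the far end, `p j b` dominates them all. Otherwise one that does, `s`, must be
adjacent to every singly dominated vertex of the other end class. -/
lemma IsPathComponent.le_card_multiplyDominated
    (hp : ∀ i k, i ≠ k → ∀ a b, ¬ G.Adj (p i a) (p k b)) (hΔ : ∀ v, G.degree v ≤ Δ)
    (hn : ∀ i, n ≤ (univ.filter (d · = i)).card)
    (hno : ∀ S : Finset V, G.IsIndepSet (S : Set V) → Set.InjOn d (S : Set V) → S.card ≠ 5)
    (hdom : ∀ v, ∃ i b, G.Adj v (p i b)) {j k : Fin 4} {b : Bool} (hne : d (p j !b) ≠ d (p k true))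
    (h : IsPathComponent (fun i b => d (p i b)) j b k) :
    n ≤ ((multiplyDominated G p).filter (d · = d (p j !b))).card + Δ ∨
      n ≤ ((multiplyDominated G p).filter (d · = d (p k true))).card + Δ := by
  by_cases hs : ∃ s, d s = d (p j !b) ∧ ∀ i a, G.Adj s (p i a) → i = k ∧ a = true
  · obtain ⟨s, hds, hs⟩ := hs
    refine Or.inr (le_card_multiplyDominated_of_dominated hΔ hn (u := s) fun v hdv hvR => ?_)
    obtain ⟨i, a, hadj, hv⟩ := exists_unique_neighbor hdom hvR
    by_contra hsv
    rcases h.2 i a with h' | h'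
    · change Avoids _ (d (p k true)) i a at h'
      rw [← hdv] at h'
      exact not_avoids hp hno hv h'
    · change HasChoice _ [d (p j !b), d (p k true)] at h'
      rw [← hdv, ← hds] at h'
      exact not_hasChoice_of_not_adj hp hno hv (fun j a hadj => (hs j a hadj).1) hsv
        (by rwa [hds, hdv]) h'
  · refine Or.inl (le_card_multiplyDominated_of_dominated hΔ hn (u := p j b) fun v hdv hvR => ?_)
    obtain ⟨i, a, hadj, hv⟩ := exists_unique_neighbor hdom hvR
    by_contra hvj
    rcases h.1 i a with ⟨rfl, rfl⟩ | ⟨rfl, rfl⟩ | h'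
    · exact hvj hadj.symm
    · exact hs ⟨v, hdv, hv⟩
    · change Avoids _ (d (p j !b)) i a at h'
      rw [← hdv] at h'
      exact not_avoids hp hno hv h'

lemma OneSided.le_card_multiplyDominated
    (hp : ∀ i k, i ≠ k → ∀ a b, ¬ G.Adj (p i a) (p k b)) (hΔ : ∀ v, G.degree v ≤ Δ)
    (hn : ∀ i, n ≤ (univ.filter (d · = i)).card)
    (hno : ∀ S : Finset V, G.IsIndepSet (S : Set V) → Set.InjOn d (S : Set V) → S.card ≠ 5)
    (hdom : ∀ v, ∃ i b, G.Adj v (p i b)) {r : Fin 6} {j : Fin 4} {b : Bool}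
    (h : OneSided (fun i b => d (p i b)) r j b) :
    n ≤ ((multiplyDominated G p).filter (d · = r)).card + Δ := by
  refine le_card_multiplyDominated_of_dominated hΔ hn (u := p j b) fun v hdv hvR => ?_
  obtain ⟨i, a, hadj, hv⟩ := exists_unique_neighbor hdom hvR
  rcases h i a with ⟨rfl, rfl⟩ | h'
  · exact hadj.symm
  · rw [← hdv] at h'
    exact absurd h' (not_avoids hp hno hv)

/-- An induced matching forming a forest on the classes forces the classes to be small. -/
theorem four_mul_le_of_isSplitForest
    (hp : ∀ i k, i ≠ k → ∀ a b, ¬ G.Adj (p i a) (p k b)) (hΔ : ∀ v, G.degree v ≤ Δ)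
    (hn : ∀ i, n ≤ (univ.filter (d · = i)).card)
    (hno : ∀ S : Finset V, G.IsIndepSet (S : Set V) → Set.InjOn d (S : Set V) → S.card ≠ 5)
    (h : IsSplitForest fun i b => d (p i b)) : 4 * n ≤ 5 * Δ := by
  have hdom : ∀ v, ∃ i b, G.Adj v (p i b) := by
    intro v
    by_contra! hv
    -- With no neighbour among the endpoints, `not_avoids` applies vacuously to any edge; edge `0`
    -- serves.
    obtain ⟨b, hb⟩ := h.1 (d v)
    exact not_avoids hp hno (fun k a hadj => absurd hadj (hv k a)) hb
  have h6 := six_mul_add_card_multiplyDominated_le hΔ hn hdom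
  -- In the first two cases two distinct classes each contain at least `n - Δ` multiply dominated
  -- vertices, so `8n ≤ 10Δ`. In the third a whole class is multiply dominated, so `7n ≤ 8Δ`.
  rcases h.2 with ⟨i, hi, h1, h2⟩ | ⟨k, j, b, -, -, hkj, h1, k', j', b', -, -, hkj', hne, h2⟩ | ⟨r, hr⟩
  · have := h1.le_card_multiplyDominated hp hΔ hn hno hdom
    have := h2.le_card_multiplyDominated hp hΔ hn hno hdom
    have := card_filter_add_card_filter_le (d := d) hi (multiplyDominated G p)
    omega
  · dsimp only at hne
    obtain ⟨hne1, hne2, hne3, hne4⟩ := hne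
    have := card_filter_add_card_filter_le (d := d) hne1 (multiplyDominated G p)
    have := card_filter_add_card_filter_le (d := d) hne2 (multiplyDominated G p)
    have := card_filter_add_card_filter_le (d := d) hne3 (multiplyDominated G p)
    have := card_filter_add_card_filter_le (d := d) hne4 (multiplyDominated G p)
    rcases h1.le_card_multiplyDominated hp hΔ hn hno hdom hkj with h1 | h1 <;>
    rcases h2.le_card_multiplyDominated hp hΔ hn hno hdom hkj' with h2 | h2 <;> omega
  · have hsub : univ.filter (d · = r) ⊆ multiplyDominated G p := by
      intro v hv
      by_contra hvR
      obtain ⟨i, a, -, hv'⟩ := exists_unique_neighbor hdom hvR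
      refine not_avoids hp hno hv' ?_
      rw [(mem_filter.1 hv).2]
      exact hr i a
    have := (hn r).trans (card_le_card hsub)
    omega

/-- Without an independent transversal of five among six classes of at least `n` vertices, the
maximum degree is at least `4 n / 5`. -/
theorem four_mul_le_five_mul_of_forall_card_ne_five {c : V → Fin 6} (hΔ : ∀ v, G.degree v ≤ Δ)
    (hn : ∀ i, n ≤ (univ.filter (c · = i)).card)
    (hno : ∀ S : Finset V, G.IsIndepSet (S : Set V) → Set.InjOn c (S : Set V) → S.card ≠ 5) :
    4 * n ≤ 5 * Δ := by
  by_contra! hlt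
  obtain ⟨x, w, Z, hZ, hw, hwZ, hx, hadj⟩ := exists_inducedMatching_forest hΔ hn hlt hno
  obtain ⟨z₀, z₁, hz, rfl⟩ := card_eq_two.1 hZ
  -- Relabelling the classes, roots first and then leaves in order of discovery, gives every edge a
  -- parent with a smaller label.
  set cl : Fin 6 → Fin 6 := Fin.cons z₀ (Fin.cons z₁ (c ∘ w) : Fin 5 → Fin 6) with hcl
  have hclinj : Function.Injective cl := by
    rw [hcl, Fin.cons_injective_iff, Fin.cons_injective_iff]
    refine ⟨?_, ?_, hw⟩
    · rintro ⟨i, hi⟩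
      induction i using Fin.cases with
      | zero => exact hz hi.symm
      | succ i => exact hwZ i (by simp [← hi])
    · rintro ⟨i, hi⟩
      exact hwZ i (by simp [← hi])
  let e : Fin 6 ≃ Fin 6 := Equiv.ofBijective cl (Finite.injective_iff_bijective.1 hclinj)
  have he : ∀ i j, e.symm i = j ↔ i = cl j := fun i j => e.symm_apply_eq
  have hdw : ∀ i, e.symm (c (w i)) = i.succ.succ := fun i => (he _ _).2 rfl
  have hdx : ∀ i : Fin 4, (e.symm (c (x i)) : ℕ) < i + 2 := by
    intro i
    rcases hx i with h | ⟨k, hk, h⟩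
    · rcases mem_insert.1 h with h | h
      · rw [(he _ 0).2 h]
        simp
      · rw [(he _ 1).2 (mem_singleton.1 h)]
        simp
    · rw [h, hdw]
      simpa using hk
  refine hlt.not_ge (four_mul_le_of_isSplitForest (G := G) (d := fun v => e.symm (c v))
    (p := fun i b => if b then w i else x i) ?_ hΔ (fun i => ?_) ?_ ?_)
  · intro i k hik a b
    have h1 := hadj i k hik
    have h2 := hadj k i hik.symm
    rcases a <;> rcases b
    · exact h1.1
    · exact h1.2.1
    · exact fun h => h2.2.1 h.symm
    · exact h1.2.2
  · simpa only [he] using hn (cl i)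
  · exact fun S h1 h2 => hno S h1 fun v hv v' hv' h => h2 hv hv' (congrArg e.symm h)
  · convert isSplitForest hdx using 1
    funext i b
    cases b
    · rfl
    · exact hdw i

end ForestMatching

/-! ### Independent transversals as cliques of the multipartite complement -/

section MultipartiteComplement

open Finset

variable {V K : Type*}

/-- The complement of `G` in the complete multipartite graph on the classes of `c`. -/
def multipartiteCompl (G : SimpleGraph V) (c : V → K) : SimpleGraph V where
  Adj u v := c u ≠ c v ∧ ¬ G.Adj u v
  symm := ⟨fun _ _ h => ⟨h.1.symm, fun h' => h.2 h'.symm⟩⟩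
  loopless := ⟨fun _ h => h.1 rfl⟩

variable {G : SimpleGraph V} {c : V → K}

lemma multipartiteCompl_adj {u v : V} :
    (multipartiteCompl G c).Adj u v ↔ c u ≠ c v ∧ ¬ G.Adj u v := Iff.rfl

lemma cliqueFree_multipartiteCompl {t : ℕ}
    (hno : ∀ S : Finset V, G.IsIndepSet (S : Set V) → Set.InjOn c (S : Set V) → S.card ≠ t) :
    (multipartiteCompl G c).CliqueFree t := by
  intro S hS
  have hadj : ∀ u ∈ S, ∀ v ∈ S, u ≠ v → c u ≠ c v ∧ ¬ G.Adj u v :=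
    fun u hu v hv huv => hS.isClique hu hv huv
  refine hno S (fun u hu v hv huv => (hadj u hu v hv huv).2) (fun u hu v hv huv => ?_) hS.card_eq
  by_contra hne
  exact (hadj u hu v hv hne).1 huv

lemma SimpleGraph.CliqueFree.card_ne_of_isIndepSet_multipartiteCompl {t : ℕ} (h : G.CliqueFree t)
    (S : Finset V) (hS : (multipartiteCompl G c).IsIndepSet (S : Set V))
    (hc : Set.InjOn c (S : Set V)) : S.card ≠ t := by
  intro hcard
  refine h S ⟨fun u hu v hv huv => ?_, hcard⟩
  by_contra hadj
  exact hS hu hv huv ⟨fun e => huv (hc hu hv e), hadj⟩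

lemma degree_add_degree_multipartiteCompl [Fintype V] [Fintype K] [DecidableEq K]
    [DecidableRel G.Adj] [DecidableRel (multipartiteCompl G c).Adj] (hG : ∀ u v, G.Adj u v → c u ≠ c v)
    {n : ℕ} (hn : ∀ i, (univ.filter (c · = i)).card = n) (v : V) :
    G.degree v + (multipartiteCompl G c).degree v = (Fintype.card K - 1) * n := by
  classical
  have hcard : ((univ : Finset V).filter fun u => c u ≠ c v).card = (Fintype.card K - 1) * n := by
    have h := card_eq_sum_card_fiberwise (f := c)
      (s := (univ : Finset V).filter fun u => c u ≠ c v) (t := univ.erase (c v))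
      (fun u hu => by simpa using hu)
    rw [h, sum_congr rfl fun i hi => ?_, sum_const, card_erase_of_mem (mem_univ _), card_univ,
      smul_eq_mul]
    rw [← hn i, filter_filter]
    congr 1
    ext u
    simp only [mem_filter, mem_univ, true_and]
    exact ⟨fun h => h.2, fun h => ⟨h ▸ ne_of_mem_erase hi, h⟩⟩
  rw [← hcard, ← G.card_neighborFinset_eq_degree, ← SimpleGraph.card_neighborFinset_eq_degree,
    ← card_union_of_disjoint]
  · congr 1
    ext u
    simp only [mem_union, SimpleGraph.mem_neighborFinset, mem_filter, mem_univ, true_and,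
      multipartiteCompl_adj]
    refine ⟨?_, fun h => ?_⟩
    · rintro (h | h)
      · exact (hG _ _ h).symm
      · exact h.1.symm
    · by_cases hadj : G.Adj v u
      · exact Or.inl hadj
      · exact Or.inr ⟨h.symm, hadj⟩
  · rw [Finset.disjoint_left]
    intro u hu hu'
    rw [SimpleGraph.mem_neighborFinset] at hu hu'
    exact hu'.2 hu

lemma SimpleGraph.Coloring.ncard_colorClass [Fintype V] [DecidableEq K] (c : G.Coloring K) (i : K) :
    (c.colorClass i).ncard = (univ.filter (c · = i)).card := by
  rw [← Set.ncard_coe_finset]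
  congr 1
  ext v
  simp [SimpleGraph.Coloring.colorClass]

end MultipartiteComplement

/-! ### The extremal graph -/

section Construction

open Finset

/-- Six classes of size `n`, grouped into three pairs: the first `m` vertices of paired classes
are completely joined, and so are the remaining vertices of classes from different pairs. -/
def pairedGraph (n m : ℕ) : SimpleGraph (Fin 6 × Fin n) where
  Adj u v := ((u.1 ≠ v.1 ∧ (u.1 : ℕ) / 2 = v.1 / 2) ∧ (u.2 : ℕ) < m ∧ (v.2 : ℕ) < m) ∨
    ((u.1 : ℕ) / 2 ≠ v.1 / 2 ∧ m ≤ u.2 ∧ m ≤ v.2)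
  symm := ⟨fun _ _ h => h.imp (fun h => ⟨⟨h.1.1.symm, h.1.2.symm⟩, h.2.symm⟩)
    fun h => ⟨h.1.symm, h.2.symm⟩⟩
  loopless := ⟨fun _ h => h.elim (fun h => h.1.1 rfl) fun h => h.1 rfl⟩

variable {n m : ℕ}

lemma pairedGraph_adj {u v : Fin 6 × Fin n} : (pairedGraph n m).Adj u v ↔
    ((u.1 ≠ v.1 ∧ (u.1 : ℕ) / 2 = v.1 / 2) ∧ (u.2 : ℕ) < m ∧ (v.2 : ℕ) < m) ∨
      ((u.1 : ℕ) / 2 ≠ v.1 / 2 ∧ m ≤ u.2 ∧ m ≤ v.2) := Iff.rfl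

lemma pairedGraph_adj_fst_ne {u v : Fin 6 × Fin n} (h : (pairedGraph n m).Adj u v) :
    u.1 ≠ v.1 := by
  rcases h with h | h
  · exact h.1.1
  · exact fun e => h.1 (by rw [e])

/-- The colouring of `pairedGraph n m` by its six classes. -/
def pairedGraphColoring (n m : ℕ) : (pairedGraph n m).Coloring (Fin 6) :=
  SimpleGraph.Coloring.mk Prod.fst pairedGraph_adj_fst_ne

lemma card_filter_fst_eq (i : Fin 6) :
    ((univ : Finset (Fin 6 × Fin n)).filter fun v => v.1 = i).card = n := by
  have : ((univ : Finset (Fin 6 × Fin n)).filter fun v => v.1 = i) = {i} ×ˢ univ := by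
    ext v
    simp only [mem_filter, mem_product, mem_singleton, mem_univ, true_and, and_true]
  simp [this]

lemma card_filter_val_lt_of_le (h : m ≤ n) :
    ((univ : Finset (Fin n)).filter fun b : Fin n => (b : ℕ) < m).card = m := by
  simp [Fin.card_filter_val_lt, h]

lemma pairedGraph_degree_of_lt [DecidableRel (pairedGraph n m).Adj] (h : m ≤ n)
    {v : Fin 6 × Fin n} (hv : (v.2 : ℕ) < m) : (pairedGraph n m).degree v = m := by
  have hset : (pairedGraph n m).neighborFinset v =
      (univ.filter fun j : Fin 6 => v.1 ≠ j ∧ (v.1 : ℕ) / 2 = j / 2) ×ˢ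
        univ.filter fun b : Fin n => (b : ℕ) < m := by
    ext u
    simp only [SimpleGraph.mem_neighborFinset, pairedGraph_adj, mem_product, mem_filter, mem_univ,
      true_and]
    constructor
    · rintro (h | h)
      · exact ⟨h.1, h.2.2⟩
      · omega
    · exact fun h => Or.inl ⟨h.1, hv, h.2⟩
  have hone : ∀ i : Fin 6, (univ.filter fun j : Fin 6 => i ≠ j ∧ (i : ℕ) / 2 = j / 2).card = 1 := by
    decide
  rw [← SimpleGraph.card_neighborFinset_eq_degree, hset, card_product, hone,
    card_filter_val_lt_of_le h, one_mul]

/-- A vertex beyond the first `m` of its class has at most `4(n - m)` neighbours, and `hm` says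
exactly that this is at most `m`. -/
lemma pairedGraph_degree_le [DecidableRel (pairedGraph n m).Adj] (h : m ≤ n) (hm : 4 * n ≤ 5 * m)
    (v : Fin 6 × Fin n) : (pairedGraph n m).degree v ≤ m := by
  rcases lt_or_ge (v.2 : ℕ) m with hv | hv
  · exact (pairedGraph_degree_of_lt h hv).le
  have hsub : (pairedGraph n m).neighborFinset v ⊆
      (univ.filter fun j : Fin 6 => (v.1 : ℕ) / 2 ≠ j / 2) ×ˢ
        univ.filter fun b : Fin n => ¬ (b : ℕ) < m := by
    intro u hu
    simp only [SimpleGraph.mem_neighborFinset, pairedGraph_adj] at hu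
    simp only [mem_product, mem_filter, mem_univ, true_and]
    omega
  have hfour : ∀ i : Fin 6, (univ.filter fun j : Fin 6 => (i : ℕ) / 2 ≠ j / 2).card = 4 := by
    decide
  have hadd := card_filter_add_card_filter_not (s := (univ : Finset (Fin n)))
    (fun b : Fin n => (b : ℕ) < m)
  rw [card_filter_val_lt_of_le h, card_univ, Fintype.card_fin] at hadd
  have hle := card_le_card hsub
  rw [SimpleGraph.card_neighborFinset_eq_degree, card_product, hfour] at hle
  omega

/-- Five of the six classes include two complete pairs. Independence forces a vertex beyond the
first `m` in each of these pairs, and two such vertices are adjacent. -/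
lemma pairedGraph_card_ne_five (S : Finset (Fin 6 × Fin n))
    (hS : (pairedGraph n m).IsIndepSet (S : Set (Fin 6 × Fin n)))
    (hc : Set.InjOn Prod.fst (S : Set (Fin 6 × Fin n))) : S.card ≠ 5 := by
  intro hcard
  have himg : (S.image Prod.fst).card = 5 := by rw [card_image_of_injOn hc, hcard]
  obtain ⟨i₀, hi₀⟩ : ∃ i₀, univ \ S.image Prod.fst = {i₀} := by
    rw [← card_eq_one, card_sdiff_of_subset (subset_univ _), himg, card_univ, Fintype.card_fin]
  have hmem : ∀ i, i ≠ i₀ → ∃ v ∈ S, v.1 = i := by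
    intro i hi
    by_contra hcon
    have : i ∈ univ \ S.image Prod.fst := by
      simp only [mem_sdiff, mem_univ, true_and, mem_image]
      exact hcon
    rw [hi₀, mem_singleton] at this
    exact hi this
  have hextra : ∀ i j : Fin 6, i ≠ j → (i : ℕ) / 2 = j / 2 → i ≠ i₀ → j ≠ i₀ →
      ∃ v ∈ S, (v.1 : ℕ) / 2 = i / 2 ∧ m ≤ v.2 := by
    intro i j hij hpair hi hj
    obtain ⟨u, hu, rfl⟩ := hmem i hi
    obtain ⟨v, hv, rfl⟩ := hmem j hj
    by_contra! hcon
    exact hS hu hv (fun e => hij (congrArg Prod.fst e))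
      (Or.inl ⟨⟨hij, hpair⟩, hcon u hu rfl, hcon v hv hpair.symm⟩)
  obtain ⟨a, b, a', b', ⟨h1, h2, h3, h4⟩, ⟨h5, h6, h7, h8⟩, h9⟩ : ∃ a b a' b' : Fin 6,
      (a ≠ b ∧ (a : ℕ) / 2 = b / 2 ∧ a ≠ i₀ ∧ b ≠ i₀) ∧
        (a' ≠ b' ∧ (a' : ℕ) / 2 = b' / 2 ∧ a' ≠ i₀ ∧ b' ≠ i₀) ∧ (a : ℕ) / 2 ≠ a' / 2 := by
    clear hi₀ hmem hextra
    revert i₀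
    decide
  obtain ⟨u, hu, hua, hum⟩ := hextra a b h1 h2 h3 h4
  obtain ⟨v, hv, hva, hvm⟩ := hextra a' b' h5 h6 h7 h8
  have huv : (u.1 : ℕ) / 2 ≠ v.1 / 2 := by rwa [hua, hva]
  exact hS hu hv (fun e => huv (by rw [e])) (Or.inr ⟨huv, hum, hvm⟩)

end Construction

/-! ### The two extremal values -/

open Classical in
lemma isGreatest_transversalFreeSizes (Δ : ℕ) :
    IsGreatest (transversalFreeSizes 6 2 Δ) (5 * Δ / 4) := by
  refine ⟨⟨Fin 6 × Fin (5 * Δ / 4), inferInstance, pairedGraph _ Δ, pairedGraphColoring _ Δ,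
    fun i => ?_, ?_, ?_⟩, ?_⟩
  · rw [SimpleGraph.Coloring.ncard_colorClass]
    exact (card_filter_fst_eq i).ge
  · refine le_antisymm (SimpleGraph.maxDegree_le_of_forall_degree_le (pairedGraph _ Δ) Δ
      (pairedGraph_degree_le (by omega) (by omega))) ?_
    rcases Nat.eq_zero_or_pos Δ with rfl | hΔ
    · exact Nat.zero_le _
    · let v₀ : Fin 6 × Fin (5 * Δ / 4) := (0, ⟨0, by omega⟩)
      exact (pairedGraph_degree_of_lt (v := v₀) (by omega) hΔ).ge.trans
        ((pairedGraph (5 * Δ / 4) Δ).degree_le_maxDegree v₀)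
  · rintro ⟨S, hS, hc, hcard⟩
    exact pairedGraph_card_ne_five S hS hc hcard
  · rintro n ⟨V, _, G, c, hn, hΔ, hno⟩
    have := four_mul_le_five_mul_of_forall_card_ne_five (G := G) (c := c) (Δ := Δ) (n := n)
      (fun v => hΔ ▸ G.degree_le_maxDegree v)
      (fun i => by rw [← SimpleGraph.Coloring.ncard_colorClass]; exact hn i)
      (fun S hS hc hcard => hno ⟨S, hS, hc, hcard⟩)
    omega

open Classical in
lemma isGreatest_cliqueFreeMinDegrees {n : ℕ} (hn : 1 ≤ n) :
    IsGreatest (cliqueFreeMinDegrees n 6 5) (21 * n / 5) := by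
  refine ⟨?_, ?_⟩
  -- The least `m` with `4n ≤ 5m`; then `5n - m = ⌊21n/5⌋`.
  · obtain ⟨m, hm⟩ : ∃ m, m = (4 * n + 4) / 5 := ⟨_, rfl⟩
    have hdeg : ∀ v, (pairedGraph n m).degree v +
        (multipartiteCompl (pairedGraph n m) Prod.fst).degree v = 5 * n :=
      degree_add_degree_multipartiteCompl (fun _ _ => pairedGraph_adj_fst_ne) card_filter_fst_eq
    let v₀ : Fin 6 × Fin n := (0, ⟨0, hn⟩)
    have : Nonempty (Fin 6 × Fin n) := ⟨v₀⟩
    refine ⟨Fin 6 × Fin n, inferInstance, multipartiteCompl (pairedGraph n m) Prod.fst,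
      SimpleGraph.Coloring.mk Prod.fst fun h => h.1, fun i => ?_,
      cliqueFree_multipartiteCompl pairedGraph_card_ne_five, le_antisymm ?_ ?_⟩
    · rw [SimpleGraph.Coloring.ncard_colorClass]
      exact card_filter_fst_eq i
    · refine (SimpleGraph.minDegree_le_degree _ v₀).trans ?_
      have := hdeg v₀
      rw [pairedGraph_degree_of_lt (by omega) (show ((v₀.2 : Fin n) : ℕ) < m by
        show 0 < m
        omega)] at this
      omega
    · refine SimpleGraph.le_minDegree_of_forall_le_degree _ _ fun v => ?_
      have := hdeg v
      have := pairedGraph_degree_le (n := n) (m := m) (by omega) (by omega) v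
      omega
  · rintro δ ⟨V, _, G, c, hcn, hfree, rfl⟩
    have hcn' : ∀ i, (Finset.univ.filter (c · = i)).card = n := fun i => by
      rw [← SimpleGraph.Coloring.ncard_colorClass]
      exact hcn i
    have hdeg : ∀ v, G.degree v + (multipartiteCompl G c).degree v = 5 * n :=
      degree_add_degree_multipartiteCompl (fun _ _ h => c.valid h) hcn'
    -- For `δ = G.minDegree`, `4n ≤ 5(5n - δ)` rearranges to `5δ ≤ 21n`. Truncation of `5n - δ` is
    -- harmless: it would give `4n ≤ 0`, against `1 ≤ n`.
    have := four_mul_le_five_mul_of_forall_card_ne_five (G := multipartiteCompl G c) (c := c)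
      (Δ := 5 * n - G.minDegree) (n := n)
      (fun v => by
        have := hdeg v
        have := G.minDegree_le_degree v
        omega)
      (fun i => (hcn' i).ge) hfree.card_ne_of_isIndepSet_multipartiteCompl
    omega

theorem corollary1p5 :
    (∀ Δ : ℕ, IsGreatest (transversalFreeSizes 6 2 Δ) ⌊(5 / 4 : ℚ) * (Δ : ℚ)⌋₊) ∧
    (∀ n : ℕ, 1 ≤ n → IsGreatest (cliqueFreeMinDegrees n 6 5) ⌊(21 / 5 : ℚ) * (n : ℚ)⌋₊) := by
  refine ⟨fun Δ => ?_, fun n hn => ?_⟩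
  · have h : (5 / 4 : ℚ) * (Δ : ℚ) = ((5 * Δ : ℕ) : ℚ) / ((4 : ℕ) : ℚ) := by
      push_cast
      ring
    rw [h, Nat.floor_div_eq_div]
    exact isGreatest_transversalFreeSizes Δ
  · have h : (21 / 5 : ℚ) * (n : ℚ) = ((21 * n : ℕ) : ℚ) / ((5 : ℕ) : ℚ) := by
      push_cast
      ring
    rw [h, Nat.floor_div_eq_div]
    exact isGreatest_cliqueFreeMinDegrees hn
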